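/- Let $R$ be a ring with unity. Call $R$ left semihereditary if every finitely generated left ideal of $R$ is projective, and call a module stable if it has no nonzero projective direct summand. For a right (resp. left) $R$-module $X$ let $X^*=\operatorname{Hom}_R(X,R)$, a left (resp. right) $R$-module. If $M$ is a finitely presented right $R$-module and $\gamma:\ P_1\xrightarrow{f}P_0\to M\to 0$ is an exact sequence of right $R$-modules with $P_0,P_1$ finitely generated projective, let $\operatorname{Tr}_\gamma(M)=\operatorname{Coker}(f^*:P_0^*\to P_1^*)$, a left $R$-module (the Auslander–Bridger transpose of $M$ with respect to $\gamma$). Let $R$ be a left semihereditary ring and $M$ a finitely presented right $R$-module. Then there are submodules $P$ and $N$ of $M$ such that $M=P\oplus N$, $P$ is projective, $N$ is stable, and, as right $R$-modules, \[ P\cong M^{**}\qquad\text{and}\qquad N\cong \operatorname{Ext}^1_R(\operatorname{Tr}_\gamma(M),R)\ \text{ for every such presentation } \gamma \text{ of } M, \] where the right $R$-module structure of $\operatorname{Ext}^1_R(\operatorname{Tr}_\gamma(M),R)$ is induced by that of the bimodule ${}_RR_R$. -/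

import Mathlib

/-!
Throughout, `R` is an arbitrary ring with unity. Left `R`-modules are `Module R X`, and right
`R`-modules are modules over the opposite ring, `Module Rᵐᵒᵖ M`.
-/

universe u v w

/-- A ring is left semihereditary if every finitely generated left ideal is projective
(as a left module). -/
def IsLeftSemihereditary (R : Type u) [Ring R] : Prop :=
  ∀ I : Ideal R, I.FG → Module.Projective R I

/-- A module is stable if it has no nonzero projective direct summand. -/
def IsStableModule (S : Type u) [Ring S] (M : Type v) [AddCommGroup M] [Module S M] : Prop :=
  ∀ P N : Submodule S M, IsCompl P N → Module.Projective S P → P = ⊥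

/-- The dual `M^* = Hom_R(M, R)` of a right `R`-module `M`. It is a left `R`-module through
`(r • φ) m = r * φ m`. -/
abbrev RightDual (R : Type u) [Ring R] (M : Type v) [AddCommGroup M] [Module Rᵐᵒᵖ M] :
    Type (max u v) :=
  M →ₗ[Rᵐᵒᵖ] R

/-- The dual `X^* = Hom_R(X, R)` of a left `R`-module `X`. It is a right `R`-module through
`(φ r) x = φ x * r`. -/
abbrev LeftDual (R : Type u) [Ring R] (X : Type v) [AddCommGroup X] [Module R X] :
    Type (max u v) :=
  X →ₗ[R] R

/-- The left `R`-linear map `f^* : Q^* → P^*`, `φ ↦ φ ∘ f`, induced by a homomorphism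
`f : P → Q` of right `R`-modules. -/
def rightDualMap {R : Type u} [Ring R] {P : Type v} [AddCommGroup P] [Module Rᵐᵒᵖ P]
    {Q : Type w} [AddCommGroup Q] [Module Rᵐᵒᵖ Q] (f : P →ₗ[Rᵐᵒᵖ] Q) :
    RightDual R Q →ₗ[R] RightDual R P where
  toFun φ := φ.comp f
  map_add' _ _ := rfl
  map_smul' _ _ := rfl

/-- A projective presentation `P₁ → P₀ → M → 0` (exact, with `P₀` and `P₁` finitely generated
projective) of a right `R`-module `M`. Since finitely generated `R`-modules are essentially small
relative to `R`, the modules `P₀`, `P₁` are taken in the universe of `R`; `M` may live anywhere. -/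
structure FGProjectivePresentation (R : Type u) [Ring R] (M : Type v) [AddCommGroup M]
    [Module Rᵐᵒᵖ M] where
  P₁ : Type u
  P₀ : Type u
  [addCommGroup₁ : AddCommGroup P₁]
  [addCommGroup₀ : AddCommGroup P₀]
  [module₁ : Module Rᵐᵒᵖ P₁]
  [module₀ : Module Rᵐᵒᵖ P₀]
  finite₁ : Module.Finite Rᵐᵒᵖ P₁
  finite₀ : Module.Finite Rᵐᵒᵖ P₀
  projective₁ : Module.Projective Rᵐᵒᵖ P₁
  projective₀ : Module.Projective Rᵐᵒᵖ P₀
  f : P₁ →ₗ[Rᵐᵒᵖ] P₀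
  g : P₀ →ₗ[Rᵐᵒᵖ] M
  exact : Function.Exact f g
  surjective : Function.Surjective g

attribute [instance] FGProjectivePresentation.addCommGroup₁
  FGProjectivePresentation.addCommGroup₀ FGProjectivePresentation.module₁
  FGProjectivePresentation.module₀

/-- The Auslander–Bridger transpose `Tr_γ(M) = Coker (f^* : P₀^* → P₁^*)` of `M` with respect to
the projective presentation `γ : P₁ → P₀ → M → 0`; it is a left `R`-module. -/
abbrev FGProjectivePresentation.Tr {R : Type u} [Ring R] {M : Type v} [AddCommGroup M]
    [Module Rᵐᵒᵖ M] (γ : FGProjectivePresentation R M) : Type u :=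
  RightDual R γ.P₁ ⧸ LinearMap.range (rightDualMap γ.f)

/-- The group `Ext^n_R(X, R)` for a left `R`-module `X`, computed in the category of left
`R`-modules. -/
abbrev ExtRing (R : Type u) [Ring R] (X : Type u) [AddCommGroup X] [Module R X] (n : ℕ) : Type u :=
  CategoryTheory.Abelian.Ext (ModuleCat.of R X) (ModuleCat.of R R) n

/-- Right multiplication `x ↦ x * r` by an element of `R`, as an endomorphism of the left
`R`-module `R` (here `s = op r`). -/
def rightMulHom (R : Type u) [Ring R] (s : Rᵐᵒᵖ) : ModuleCat.of R R ⟶ ModuleCat.of R R :=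
  ModuleCat.ofHom
    { toFun := fun x => x * s.unop
      map_add' := fun x y => add_mul x y s.unop
      map_smul' := fun a x => mul_assoc a x s.unop }

/-- The right `R`-module structure of `Ext^n_R(X, R)` coming from the bimodule `R`: the element
`r` acts as the map `Ext^n_R(X, R) → Ext^n_R(X, R)` induced by right multiplication by `r`
on `R`. -/
noncomputable instance ExtRing.instModule (R : Type u) [Ring R] (X : Type u)
    [AddCommGroup X] [Module R X] (n : ℕ) : Module Rᵐᵒᵖ (ExtRing R X n) where
  smul s x := CategoryTheory.Abelian.Ext.comp x
    (CategoryTheory.Abelian.Ext.mk₀ (rightMulHom R s)) (add_zero n)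
  one_smul x := by
    have h : rightMulHom R 1 = CategoryTheory.CategoryStruct.id _ := by
      ext; simp [rightMulHom]
    change CategoryTheory.Abelian.Ext.comp x (CategoryTheory.Abelian.Ext.mk₀ _) _ = x
    rw [h, CategoryTheory.Abelian.Ext.comp_mk₀_id]
  mul_smul s t x := by
    have h : rightMulHom R (s * t) =
        CategoryTheory.CategoryStruct.comp (rightMulHom R t) (rightMulHom R s) := by
      ext; simp [rightMulHom]
    change CategoryTheory.Abelian.Ext.comp x (CategoryTheory.Abelian.Ext.mk₀ _) _ =
      CategoryTheory.Abelian.Ext.comp (CategoryTheory.Abelian.Ext.comp x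
        (CategoryTheory.Abelian.Ext.mk₀ _) _) (CategoryTheory.Abelian.Ext.mk₀ _) _
    rw [h, CategoryTheory.Abelian.Ext.comp_assoc_of_second_deg_zero,
      CategoryTheory.Abelian.Ext.mk₀_comp_mk₀]
  smul_zero s := CategoryTheory.Abelian.Ext.zero_comp _ _ _ _ _
  smul_add s x y := CategoryTheory.Abelian.Ext.add_comp _ _ _ _
  add_smul s t x := by
    have h : rightMulHom R (s + t) = rightMulHom R s + rightMulHom R t := by
      ext; simp [rightMulHom]
    change CategoryTheory.Abelian.Ext.comp x (CategoryTheory.Abelian.Ext.mk₀ _) _ =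
      CategoryTheory.Abelian.Ext.comp x (CategoryTheory.Abelian.Ext.mk₀ _) _ +
      CategoryTheory.Abelian.Ext.comp x (CategoryTheory.Abelian.Ext.mk₀ _) _
    rw [h, CategoryTheory.Abelian.Ext.mk₀_add, CategoryTheory.Abelian.Ext.comp_add]
  zero_smul x := by
    have h : rightMulHom R 0 = 0 := by
      ext; simp [rightMulHom]
    change CategoryTheory.Abelian.Ext.comp x (CategoryTheory.Abelian.Ext.mk₀ _) _ = 0
    rw [h, CategoryTheory.Abelian.Ext.mk₀_zero, CategoryTheory.Abelian.Ext.comp_zero]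

open CategoryTheory

section DualBasis

variable {R : Type u} [Ring R] {P : Type v} [AddCommGroup P] [Module Rᵐᵒᵖ P]

/-- The coordinate `Rᵐᵒᵖ → R` as a homomorphism of right modules. -/
def MulOpposite.unopRightLinear (R : Type u) [Ring R] : Rᵐᵒᵖ →ₗ[Rᵐᵒᵖ] R where
  toFun := MulOpposite.unop
  map_add' _ _ := rfl
  map_smul' _ _ := rfl

/-- Elements of a projective right module are separated by its dual. -/
theorem eq_zero_of_forall_rightDual [Module.Projective Rᵐᵒᵖ P] {x : P}
    (h : ∀ φ : RightDual R P, φ x = 0) : x = 0 := by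
  obtain ⟨s, hs⟩ := (Module.projective_def (R := Rᵐᵒᵖ) (P := P)).1 inferInstance
  rw [← hs x]
  have : s x = 0 := by
    ext p
    have := h ((MulOpposite.unopRightLinear R) ∘ₗ Finsupp.lapply p ∘ₗ s)
    exact MulOpposite.unop_injective this
  rw [this, map_zero]

/-- A finitely generated projective right module has a finite dual basis. -/
theorem exists_rightDual_basis (R : Type u) [Ring R] (P : Type v) [AddCommGroup P]
    [Module Rᵐᵒᵖ P] [Module.Finite Rᵐᵒᵖ P] [Module.Projective Rᵐᵒᵖ P] :
    ∃ (n : ℕ) (p : Fin n → P) (φ : Fin n → RightDual R P),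
      ∀ x, ∑ i, MulOpposite.op (φ i x) • p i = x := by
  obtain ⟨n, f, hf⟩ := Module.Finite.exists_fin' Rᵐᵒᵖ P
  obtain ⟨s, hs⟩ := Module.projective_lifting_property f LinearMap.id hf
  refine ⟨n, fun i => f (Pi.single i 1),
    fun i => (MulOpposite.unopRightLinear R) ∘ₗ LinearMap.proj i ∘ₗ s, fun x => ?_⟩
  conv_rhs => rw [← LinearMap.id_apply (R := Rᵐᵒᵖ) x, ← hs, LinearMap.comp_apply,
    pi_eq_sum_univ' (s x), map_sum]
  refine Finset.sum_congr rfl fun i _ => ?_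
  rw [map_smul]
  congr 2

/-- Evaluation of the elements of the dual at a finite family. -/
def rightDualEvalAt {n : ℕ} (p : Fin n → P) : RightDual R P →ₗ[R] (Fin n → R) where
  toFun ψ i := ψ (p i)
  map_add' _ _ := rfl
  map_smul' _ _ := rfl

variable {n : ℕ} {p : Fin n → P} {φ : Fin n → RightDual R P}

theorem rightDual_eq_sum (h : ∀ x, ∑ i, MulOpposite.op (φ i x) • p i = x) (ψ : RightDual R P) :
    ψ = ∑ i, ψ (p i) • φ i := by
  ext x
  conv_lhs => rw [← h x]
  simp [map_sum]

theorem apply_sum_op_smul_of_dual_basis (h : ∀ x, ∑ i, MulOpposite.op (φ i x) • p i = x)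
    (Λ : LeftDual R (RightDual R P)) (ψ : RightDual R P) :
    ψ (∑ i, MulOpposite.op (Λ (φ i)) • p i) = Λ ψ := by
  conv_rhs => rw [rightDual_eq_sum h ψ]
  simp [map_sum]

end DualBasis

section Semihereditary

variable {R : Type u} [Ring R]

/-- Over a left semihereditary ring, finitely generated submodules of finite free left modules
are projective. -/
theorem IsLeftSemihereditary.projective_of_injective (hR : IsLeftSemihereditary R) (n : ℕ) :
    ∀ {X : Type v} [AddCommGroup X] [Module R X] [Module.Finite R X]
      (e : X →ₗ[R] (Fin n → R)), Function.Injective e → Module.Projective R X := by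
  induction n with
  | zero =>
    intro X _ _ _ e he
    have : Subsingleton X := he.subsingleton
    infer_instance
  | succ n ih =>
    intro X _ _ _ e he
    let q : X →ₗ[R] R := LinearMap.proj (Fin.last n) ∘ₗ e
    have hJ : Module.Projective R (LinearMap.range q) :=
      hR (LinearMap.range q) ((Submodule.fg_top _).1 (Module.Finite.fg_top))
    obtain ⟨s, hs⟩ := Module.projective_lifting_property q.rangeRestrict LinearMap.id
      q.surjective_rangeRestrict
    have hs' (y) : q (s y) = y := congrArg Subtype.val (LinearMap.congr_fun hs y)
    let r : X →ₗ[R] LinearMap.ker q :=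
      (LinearMap.id - s ∘ₗ q.rangeRestrict).codRestrict _ fun x => by
        simp [hs']
    have hr (x : X) : (r x : X) = x - s (q.rangeRestrict x) := rfl
    have : Module.Finite R (LinearMap.ker q) := Module.Finite.of_surjective r fun x => by
      refine ⟨x, Subtype.ext ?_⟩
      have : q.rangeRestrict x = 0 := Subtype.ext x.2
      rw [hr, this, map_zero, sub_zero]
    have hK : Module.Projective R (LinearMap.ker q) := by
      refine ih (LinearMap.funLeft R R Fin.castSucc ∘ₗ e ∘ₗ (LinearMap.ker q).subtype) ?_
      rw [← LinearMap.ker_eq_bot, LinearMap.ker_eq_bot']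
      intro x hx
      apply Subtype.ext
      apply he
      rw [ZeroMemClass.coe_zero, map_zero]
      ext i
      refine Fin.lastCases ?_ (fun j => ?_) i
      · exact x.2
      · exact congrFun hx j
    refine Module.Projective.of_split (M := LinearMap.ker q × LinearMap.range q)
      (r.prod q.rangeRestrict) ((LinearMap.ker q).subtype.coprod s) ?_
    ext x
    simp [hr]

/-- Over a left semihereditary ring, finitely generated submodules of duals of finitely generated
projective right modules are projective. -/
theorem IsLeftSemihereditary.projective_of_fg_rightDual (hR : IsLeftSemihereditary R)
    {P : Type v} [AddCommGroup P] [Module Rᵐᵒᵖ P] [Module.Finite Rᵐᵒᵖ P]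
    [Module.Projective Rᵐᵒᵖ P] (I : Submodule R (RightDual R P)) (hI : I.FG) :
    Module.Projective R I := by
  obtain ⟨n, p, φ, h⟩ := exists_rightDual_basis R P
  have : Module.Finite R I := Module.Finite.of_fg hI
  refine hR.projective_of_injective (X := I) n (rightDualEvalAt p ∘ₗ I.subtype) fun ψ ψ' hψ => ?_
  apply Subtype.ext
  rw [rightDual_eq_sum h ψ.1, rightDual_eq_sum h ψ'.1]
  exact Finset.sum_congr rfl fun i _ => by rw [show ψ.1 (p i) = ψ'.1 (p i) from congrFun hψ i]

end Semihereditary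

section RightDual

variable {R : Type u} [Ring R]

theorem finite_rightDual {P : Type v} [AddCommGroup P] [Module Rᵐᵒᵖ P] [Module.Finite Rᵐᵒᵖ P]
    [Module.Projective Rᵐᵒᵖ P] : Module.Finite R (RightDual R P) := by
  obtain ⟨n, p, φ, h⟩ := exists_rightDual_basis R P
  refine Module.Finite.of_surjective (Fintype.linearCombination R φ) fun ψ => ?_
  exact ⟨fun i => ψ (p i), by rw [Fintype.linearCombination_apply, ← rightDual_eq_sum h ψ]⟩

theorem projective_rightDual {P : Type v} [AddCommGroup P] [Module Rᵐᵒᵖ P]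
    [Module.Finite Rᵐᵒᵖ P] [Module.Projective Rᵐᵒᵖ P] : Module.Projective R (RightDual R P) := by
  obtain ⟨n, p, φ, h⟩ := exists_rightDual_basis R P
  refine Module.Projective.of_split (rightDualEvalAt p) (Fintype.linearCombination R φ) ?_
  refine LinearMap.ext fun ψ => ?_
  rw [LinearMap.comp_apply, Fintype.linearCombination_apply]
  exact (rightDual_eq_sum h ψ).symm

/-- The canonical homomorphism `M → M^{**}` of right modules. -/
def rightEval (R : Type u) [Ring R] (M : Type v) [AddCommGroup M] [Module Rᵐᵒᵖ M] :
    M →ₗ[Rᵐᵒᵖ] LeftDual R (RightDual R M) where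
  toFun m :=
    { toFun := fun φ => φ m
      map_add' := fun _ _ => rfl
      map_smul' := fun _ _ => rfl }
  map_add' m m' := LinearMap.ext fun φ => map_add φ m m'
  map_smul' r m := LinearMap.ext fun φ => map_smul φ r m

@[simp]
theorem rightEval_apply {M : Type v} [AddCommGroup M] [Module Rᵐᵒᵖ M] (m : M)
    (φ : RightDual R M) : rightEval R M m φ = φ m := rfl

theorem mem_ker_rightEval {M : Type v} [AddCommGroup M] [Module Rᵐᵒᵖ M] {m : M} :
    m ∈ LinearMap.ker (rightEval R M) ↔ ∀ φ : RightDual R M, φ m = 0 := by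
  rw [LinearMap.mem_ker, LinearMap.ext_iff]
  rfl

/-- The kernel of `M → M^{**}` is stable if it is a direct summand. -/
theorem isStableModule_ker_rightEval {M : Type v} [AddCommGroup M] [Module Rᵐᵒᵖ M]
    {P : Submodule Rᵐᵒᵖ M} (hP : IsCompl (LinearMap.ker (rightEval R M)) P) :
    IsStableModule Rᵐᵒᵖ (LinearMap.ker (rightEval R M)) := by
  intro A B hAB _
  rw [eq_bot_iff]
  intro x hx
  have : (⟨x, hx⟩ : A) = 0 := by
    refine eq_zero_of_forall_rightDual (R := R) (P := A) fun φ => ?_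
    have := mem_ker_rightEval.1 x.2
      (φ ∘ₗ A.projectionOnto B hAB ∘ₗ Submodule.projectionOnto _ P hP)
    rw [LinearMap.comp_apply, LinearMap.comp_apply, Submodule.projectionOnto_apply_left] at this
    rwa [Submodule.projectionOnto_apply_left hAB ⟨x, hx⟩] at this
  exact congrArg Subtype.val this

variable {P₁ : Type v} [AddCommGroup P₁] [Module Rᵐᵒᵖ P₁]
  {P₀ : Type v} [AddCommGroup P₀] [Module Rᵐᵒᵖ P₀]
  {M : Type w} [AddCommGroup M] [Module Rᵐᵒᵖ M]
  {f : P₁ →ₗ[Rᵐᵒᵖ] P₀} {g : P₀ →ₗ[Rᵐᵒᵖ] M}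

theorem rightDualMap_eq_zero_iff (hfg : Function.Exact f g) (hg : Function.Surjective g)
    (φ : RightDual R P₀) : rightDualMap f φ = 0 ↔ φ ∈ LinearMap.range (rightDualMap g) := by
  constructor
  · intro h
    have hk : LinearMap.ker g ≤ LinearMap.ker φ := by
      intro x hx
      obtain ⟨y, rfl⟩ := (hfg x).1 hx
      exact LinearMap.congr_fun h y
    refine ⟨(LinearMap.ker g).liftQ φ hk ∘ₗ
      (g.quotKerEquivOfSurjective hg).symm.toLinearMap, LinearMap.ext fun x => ?_⟩
    change (LinearMap.ker g).liftQ φ hk ((g.quotKerEquivOfSurjective hg).symm (g x)) = φ x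
    have : (g.quotKerEquivOfSurjective hg).symm (g x) = (LinearMap.ker g).mkQ x := by
      rw [LinearEquiv.symm_apply_eq]
      rfl
    rw [this]
    rfl
  · rintro ⟨ψ, rfl⟩
    refine LinearMap.ext fun x => ?_
    change ψ (g (f x)) = 0
    rw [hfg.apply_apply_eq_zero, map_zero]

theorem rightDualMap_injective (hg : Function.Surjective g) :
    Function.Injective (rightDualMap g) := fun _ _ h =>
  LinearMap.ext fun m => by
    obtain ⟨x, rfl⟩ := hg m
    exact LinearMap.congr_fun h x

/-- Over a left semihereditary ring, `M → M^{**}` is a split surjection onto a projective module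
if `M` is finitely presented. -/
theorem IsLeftSemihereditary.exists_section_rightEval (hR : IsLeftSemihereditary R)
    [Module.Finite Rᵐᵒᵖ P₁] [Module.Projective Rᵐᵒᵖ P₁]
    [Module.Finite Rᵐᵒᵖ P₀] [Module.Projective Rᵐᵒᵖ P₀]
    (hfg : Function.Exact f g) (hg : Function.Surjective g) :
    Module.Projective Rᵐᵒᵖ (LeftDual R (RightDual R M)) ∧
      ∃ s : LeftDual R (RightDual R M) →ₗ[Rᵐᵒᵖ] M, rightEval R M ∘ₗ s = LinearMap.id := by
  have := finite_rightDual (R := R) (P := P₀)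
  have : Module.Projective R (LinearMap.range (rightDualMap f)) :=
    hR.projective_of_fg_rightDual _ ((Submodule.fg_top _).1 Module.Finite.fg_top)
  obtain ⟨t, ht⟩ := Module.projective_lifting_property (rightDualMap f).rangeRestrict
    LinearMap.id (rightDualMap f).surjective_rangeRestrict
  have ht' (y) : rightDualMap f (t y) = y := congrArg Subtype.val (LinearMap.congr_fun ht y)
  let e := LinearEquiv.ofInjective (rightDualMap g) (rightDualMap_injective hg)
  let ρ : RightDual R P₀ →ₗ[R] RightDual R M := e.symm.toLinearMap ∘ₗ
    (LinearMap.id - t ∘ₗ (rightDualMap f).rangeRestrict).codRestrict _ fun φ => by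
      rw [← rightDualMap_eq_zero_iff hfg hg]
      simp [ht']
  have hρ (ψ : RightDual R M) : ρ (rightDualMap g ψ) = ψ := by
    change e.symm _ = ψ
    rw [LinearEquiv.symm_apply_eq]
    apply Subtype.ext
    have h0 : (rightDualMap f).rangeRestrict (rightDualMap g ψ) = 0 :=
      Subtype.ext ((rightDualMap_eq_zero_iff hfg hg _).2 ⟨ψ, rfl⟩)
    change rightDualMap g ψ - t ((rightDualMap f).rangeRestrict (rightDualMap g ψ)) = _
    rw [h0, map_zero, sub_zero]
    rfl
  obtain ⟨n, p, φ, h⟩ := exists_rightDual_basis R P₀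
  let s : LeftDual R (RightDual R M) →ₗ[Rᵐᵒᵖ] P₀ :=
    { toFun := fun Λ => ∑ i, MulOpposite.op (Λ (ρ (φ i))) • p i
      map_add' := fun Λ Λ' => by simp [add_smul, Finset.sum_add_distrib]
      map_smul' := fun r Λ => by
        simp only [Finset.smul_sum, smul_smul, RingHom.id_apply]
        rfl }
  have hs : (rightEval R M ∘ₗ g) ∘ₗ s = LinearMap.id := by
    refine LinearMap.ext fun Λ => LinearMap.ext fun ψ => ?_
    refine (apply_sum_op_smul_of_dual_basis h (Λ ∘ₗ ρ) (rightDualMap g ψ)).trans ?_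
    rw [LinearMap.comp_apply, hρ]
    rfl
  exact ⟨Module.Projective.of_split _ _ hs, g ∘ₗ s, hs⟩

end RightDual

section Ext

variable {R : Type u} [Ring R]

/-- If `A` is projective, then `Ext^1_R(A/I, R)` is, as a right module, the cokernel of
`A^* → I^*`. -/
theorem exists_connecting_hom {A : Type u} [AddCommGroup A] [Module R A] [Module.Projective R A]
    (I : Submodule R A) :
    ∃ δ : LeftDual R I →ₗ[Rᵐᵒᵖ] ExtRing R (A ⧸ I) 1, Function.Surjective δ ∧
      ∀ l, δ l = 0 ↔ ∃ k : LeftDual R A, k ∘ₗ I.subtype = l := by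
  let S : ShortComplex (ModuleCat.{u} R) := ShortComplex.mk (ModuleCat.ofHom I.subtype)
    (ModuleCat.ofHom I.mkQ) (by ext; simp)
  have hS : S.ShortExact :=
    { exact := by
        rw [ShortComplex.ShortExact.moduleCat_exact_iff_function_exact]
        exact LinearMap.exact_subtype_mkQ I
      mono_f := (ModuleCat.mono_iff_injective _).2 I.injective_subtype
      epi_g := (ModuleCat.epi_iff_surjective _).2 I.mkQ_surjective }
  have : Projective S.X₂ := (IsProjective.iff_projective A).1 inferInstance
  let δ : LeftDual R I →ₗ[Rᵐᵒᵖ] ExtRing R (A ⧸ I) 1 :=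
    { toFun := fun l => hS.extClass.comp (Abelian.Ext.mk₀ (ModuleCat.ofHom l)) (add_zero 1)
      map_add' := fun l l' => by
        rw [ModuleCat.ofHom_add, Abelian.Ext.mk₀_add, Abelian.Ext.comp_add]
      map_smul' := fun r l => by
        have : ModuleCat.ofHom (r • l) = ModuleCat.ofHom l ≫ rightMulHom R r := rfl
        rw [this, ← Abelian.Ext.mk₀_comp_mk₀,
          ← Abelian.Ext.comp_assoc_of_second_deg_zero]
        rfl }
  refine ⟨δ, fun x => ?_, fun l => ⟨fun h => ?_, ?_⟩⟩
  · obtain ⟨y, hy⟩ := Abelian.Ext.contravariant_sequence_exact₃ hS (ModuleCat.of R R) x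
      (Abelian.Ext.eq_zero_of_projective _) (add_zero 1)
    obtain ⟨l, rfl⟩ := Abelian.Ext.addEquiv₀.symm.surjective y
    exact ⟨l.hom, hy⟩
  · obtain ⟨y, hy⟩ := Abelian.Ext.contravariant_sequence_exact₁ hS (ModuleCat.of R R) _
      (add_zero 1) h
    obtain ⟨k, rfl⟩ := Abelian.Ext.addEquiv₀.symm.surjective y
    refine ⟨k.hom, ?_⟩
    have hk : Abelian.Ext.mk₀ (S.f ≫ k) = Abelian.Ext.mk₀ (ModuleCat.ofHom l) := by
      rw [← Abelian.Ext.mk₀_comp_mk₀]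
      exact hy
    exact congrArg ModuleCat.Hom.hom (Abelian.Ext.addEquiv₀.symm.injective hk)
  · rintro ⟨k, rfl⟩
    change hS.extClass.comp (Abelian.Ext.mk₀ (S.f ≫ ModuleCat.ofHom k)) (add_zero 1) = 0
    rw [← Abelian.Ext.mk₀_comp_mk₀]
    exact ShortComplex.ShortExact.extClass_comp_assoc hS _

/-- The kernel of `M → M^{**}` is `Ext^1_R(Tr_γ(M), R)`. -/
theorem FGProjectivePresentation.nonempty_ker_rightEval_equiv {M : Type v} [AddCommGroup M]
    [Module Rᵐᵒᵖ M] (γ : FGProjectivePresentation R M) :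
    Nonempty (LinearMap.ker (rightEval R M) ≃ₗ[Rᵐᵒᵖ] ExtRing R γ.Tr 1) := by
  have := γ.finite₀
  have := γ.finite₁
  have := γ.projective₀
  have := γ.projective₁
  have := projective_rightDual (R := R) (P := γ.P₁)
  obtain ⟨δ, hδ, hδ0⟩ := exists_connecting_hom (LinearMap.range (rightDualMap γ.f))
  let K := LinearMap.ker (rightEval R M)
  let K₀ : Submodule Rᵐᵒᵖ γ.P₀ := K.comap γ.g
  let c : K₀ →ₗ[Rᵐᵒᵖ] K := γ.g.restrict fun _ hx => hx
  have hc : Function.Surjective c := fun m => by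
    obtain ⟨x, hx⟩ := γ.surjective m
    exact ⟨⟨x, by simp only [K₀, Submodule.mem_comap, hx, m.2]⟩, Subtype.ext hx⟩
  have hwd (x : K₀) : LinearMap.ker (rightDualMap γ.f) ≤
      LinearMap.ker (rightEval R γ.P₀ x) := fun φ hφ => by
    obtain ⟨ψ, rfl⟩ := (rightDualMap_eq_zero_iff γ.exact γ.surjective φ).1 hφ
    exact mem_ker_rightEval.1 x.2 ψ
  let d (x : K₀) : LeftDual R (LinearMap.range (rightDualMap γ.f)) :=
    (LinearMap.ker (rightDualMap γ.f)).liftQ _ (hwd x) ∘ₗ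
      (rightDualMap γ.f).quotKerEquivRange.symm.toLinearMap
  have hd (x : K₀) (φ : RightDual R γ.P₀) :
      d x ((rightDualMap γ.f).rangeRestrict φ) = φ x := by
    have : (rightDualMap γ.f).quotKerEquivRange.symm ((rightDualMap γ.f).rangeRestrict φ) =
        (LinearMap.ker (rightDualMap γ.f)).mkQ φ := by
      rw [LinearEquiv.symm_apply_eq]
      rfl
    change (LinearMap.ker (rightDualMap γ.f)).liftQ _ (hwd x)
      ((rightDualMap γ.f).quotKerEquivRange.symm _) = _
    rw [this]
    rfl
  have hext {l l' : LeftDual R (LinearMap.range (rightDualMap γ.f))}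
      (h : ∀ φ, l ((rightDualMap γ.f).rangeRestrict φ) =
        l' ((rightDualMap γ.f).rangeRestrict φ)) : l = l' :=
    LinearMap.ext fun y => by
      obtain ⟨φ, rfl⟩ := (rightDualMap γ.f).surjective_rangeRestrict y
      exact h φ
  let D : K₀ →ₗ[Rᵐᵒᵖ] LeftDual R (LinearMap.range (rightDualMap γ.f)) :=
    { toFun := d
      map_add' := fun x y => hext fun φ => by
        rw [LinearMap.add_apply, hd, hd, hd]
        exact map_add φ _ _
      map_smul' := fun r x => hext fun φ => by
        rw [RingHom.id_apply, LinearMap.smul_apply, hd, hd]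
        exact map_smul φ _ _ }
  have hD : Function.Surjective D := fun l => by
    obtain ⟨n, p, φ, h⟩ := exists_rightDual_basis R γ.P₀
    have hx := apply_sum_op_smul_of_dual_basis h (l ∘ₗ (rightDualMap γ.f).rangeRestrict)
    refine ⟨⟨_, mem_ker_rightEval.2 fun ψ => (hx (rightDualMap γ.g ψ)).trans ?_⟩,
      hext fun ψ => (hd _ ψ).trans (hx ψ)⟩
    have h0 : (rightDualMap γ.f).rangeRestrict (rightDualMap γ.g ψ) = 0 :=
      Subtype.ext ((rightDualMap_eq_zero_iff γ.exact γ.surjective _).2 ⟨ψ, rfl⟩)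
    rw [LinearMap.comp_apply, h0, map_zero]
  have hker : LinearMap.ker c = LinearMap.ker (δ ∘ₗ D) := by
    ext x
    rw [LinearMap.mem_ker, LinearMap.mem_ker, LinearMap.comp_apply, hδ0]
    have hcx : c x = 0 ↔ γ.g x = 0 := Subtype.ext_iff
    rw [hcx, γ.exact (x : γ.P₀)]
    constructor
    · rintro ⟨y, hy⟩
      refine ⟨rightEval R γ.P₁ y, hext fun φ => ((hd x φ).trans ?_).symm⟩
      rw [← hy]
      rfl
    · rintro ⟨k, hk⟩
      obtain ⟨n, p, φ, h⟩ := exists_rightDual_basis R γ.P₁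
      refine ⟨∑ i, MulOpposite.op (k (φ i)) • p i,
        sub_eq_zero.1 (eq_zero_of_forall_rightDual (R := R) fun ψ => ?_)⟩
      rw [map_sub, sub_eq_zero]
      refine (apply_sum_op_smul_of_dual_basis h k (rightDualMap γ.f ψ)).trans ?_
      rw [← hd x ψ]
      exact LinearMap.congr_fun hk ((rightDualMap γ.f).rangeRestrict ψ)
  exact ⟨(c.quotKerEquivOfSurjective hc).symm ≪≫ₗ Submodule.quotEquivOfEq _ _ hker ≪≫ₗ
    (δ ∘ₗ D).quotKerEquivOfSurjective (hδ.comp hD)⟩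

end Ext

/-- Over a left semihereditary ring, a finitely presented right module `M` is the internal direct
sum of a projective submodule `P ≅ M^{**}` and a stable submodule `N`, and
`N ≅ Ext^1_R(Tr_γ(M), R)` for every projective presentation `γ` of `M` by finitely generated
projective modules. All isomorphisms are isomorphisms of right `R`-modules. -/
theorem mainTheorem1 (R : Type u) [Ring R] (hR : IsLeftSemihereditary R)
    (M : Type v) [AddCommGroup M] [Module Rᵐᵒᵖ M] (hM : Module.FinitePresentation Rᵐᵒᵖ M) :
    ∃ P N : Submodule Rᵐᵒᵖ M, IsCompl P N ∧
      Module.Projective Rᵐᵒᵖ P ∧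
      IsStableModule Rᵐᵒᵖ N ∧
      Nonempty (P ≃ₗ[Rᵐᵒᵖ] LeftDual R (RightDual R M)) ∧
      ∀ γ : FGProjectivePresentation R M, Nonempty (N ≃ₗ[Rᵐᵒᵖ] ExtRing R γ.Tr 1) := by
  obtain ⟨n, m, g, f, hg, hfg⟩ := Module.FinitePresentation.exists_fin' Rᵐᵒᵖ M
  obtain ⟨hproj, s, hs⟩ := hR.exists_section_rightEval hfg hg
  have hs' (Λ) : rightEval R M (s Λ) = Λ := LinearMap.congr_fun hs Λ
  let e := LinearEquiv.ofInjective s (Function.LeftInverse.injective hs')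
  have hc : IsCompl (LinearMap.range s) (LinearMap.ker (rightEval R M)) := by
    have := LinearMap.isCompl_of_proj (p := LinearMap.range s)
      (f := s.rangeRestrict ∘ₗ rightEval R M) fun x => by
        obtain ⟨_, Λ, rfl⟩ := x
        exact Subtype.ext (congrArg s (hs' Λ))
    rwa [LinearMap.ker_comp_of_ker_eq_bot] at this
    rw [LinearMap.ker_rangeRestrict]
    exact LinearMap.ker_eq_bot.2 (Function.LeftInverse.injective hs')
  exact ⟨LinearMap.range s, LinearMap.ker (rightEval R M), hc, Module.Projective.of_equiv' e,
    isStableModule_ker_rightEval hc.symm, ⟨e.symm⟩, fun γ => γ.nonempty_ker_rightEval_equiv⟩
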